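/- Let $\kappa$ be a (small, infinite) regular cardinal. A category $\mathsf{D}$ is called $\kappa$-extensive (resp. infinitary extensive) if it has all $\kappa$-small (resp. small) coproducts and, for every $\kappa$-small (resp. small) family $\{X_i\}_{i\in I}$ of objects of $\mathsf{D}$, the coproduct functor between slice categories $$\prod_{i\in I} \mathsf{D}/X_i \longrightarrow \mathsf{D}\Big/\Big(\coprod_{i\in I} X_i\Big),\qquad (f_i\colon A_i\to X_i)_{i\in I}\longmapsto \coprod_{i\in I} f_i,$$ is an equivalence of categories. It is called extensive if it is $\aleph_0$-extensive. For a small category $\mathsf{C}$, let $\mathrm{Ind}_\kappa(\mathsf{C})$ denote its free completion under $\kappa$-filtered colimits, i.e. the full subcategory of $[\mathsf{C}^{\mathrm{op}},\mathsf{Set}]$ on the small $\kappa$-filtered colimits of representable presheaves. Let $\mathsf{C}$ be a small category with all $\kappa$-small colimits. Then the following are equivalent: 1. $\mathsf{C}$ is $\kappa$-extensive; 2. $\mathrm{Ind}_\kappa(\mathsf{C})$ is infinitary extensive; 3. $\mathrm{Ind}_\kappa(\mathsf{C})$ is $\kappa$-extensive (for $\kappa=\aleph_0$: extensive). -/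

import Mathlib

open CategoryTheory CategoryTheory.Limits

universe w v u

namespace KappaInd

section Extensive

variable {C : Type u} [Category.{v} C]

/-- The sum functor `∏ i, C / X i ⥤ C / (∐ i, X i)` sending a family of objects
`A i ⟶ X i` to the induced map `∐ i, A i ⟶ ∐ i, X i`. -/
noncomputable def sumFunctor {I : Type w} [HasCoproductsOfShape I C] (X : I → C) :
    (∀ i, Over (X i)) ⥤ Over (∐ X) where
  obj A := Over.mk (Y := ∐ fun i => (A i).left) (Limits.Sigma.map (fun i => (A i).hom))
  map {A B} f := Over.homMk (Limits.Sigma.map (fun i => (f i).left))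
    (Sigma.hom_ext _ _ fun i => by simp)
  map_id A := Over.OverMorphism.ext (Sigma.hom_ext _ _ fun i => by simp)
  map_comp f g := Over.OverMorphism.ext (Sigma.hom_ext _ _ fun i => by simp)

variable (C)

/-- `C` has sums indexed by `I`, and for every family `X` of objects indexed by `I` the sum functor
`∏ i, C / X i ⥤ C / (∐ i, X i)` is an equivalence. -/
def ExtensiveOfShape (I : Type w) : Prop :=
  ∃ _ : HasCoproductsOfShape I C, ∀ X : I → C, (sumFunctor X).IsEquivalence

/-- `κ`-extensive categories: the condition `ExtensiveOfShape` for all `κ`-small index sets.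
(A category is called extensive if it is `ℵ₀`-extensive.) -/
def IsCardinalExtensive (κ : Cardinal.{w}) : Prop :=
  ∀ I : Type w, HasCardinalLT I κ → ExtensiveOfShape C I

/-- Infinitary extensive categories: the condition `ExtensiveOfShape` for all small
(that is, `w`-small) index sets. -/
def IsInfinitaryExtensive : Prop :=
  ∀ I : Type w, ExtensiveOfShape C I

/-- `κ`-cocomplete categories: all colimits of diagrams with fewer than `κ` morphisms exist. -/
def IsCardinalCocomplete (κ : Cardinal.{w}) : Prop :=
  ∀ (J : Type w) [SmallCategory J], HasCardinalLT (Arrow J) κ → HasColimitsOfShape J C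

end Extensive

section Ind

variable {C : Type w} [SmallCategory C]

/-- A presheaf on a small category is a `κ`-ind-object if it is a colimit, in the category of
presheaves, of a small `κ`-filtered diagram of representable presheaves. -/
def IsCardinalIndObject (κ : Cardinal.{w}) [Fact κ.IsRegular] : ObjectProperty (Cᵒᵖ ⥤ Type w) :=
  fun A => ∃ (J : Type w) (_ : SmallCategory J) (_ : IsCardinalFiltered J κ) (F : J ⥤ C)
    (ι : F ⋙ yoneda ⟶ (Functor.const J).obj A), Nonempty (IsColimit (Cocone.mk A ι))

variable (C)

/-- The free completion `Ind_κ(C)` of a small category under small `κ`-filtered colimits: the full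
subcategory of the category of presheaves on `C` consisting of the `κ`-ind-objects. -/
abbrev CardinalInd (κ : Cardinal.{w}) [Fact κ.IsRegular] : Type (w + 1) :=
  (IsCardinalIndObject (C := C) κ).FullSubcategory

end Ind

end KappaInd

/-!
Write `D` for `Ind_κ(C)` and `y : C ⥤ D` for the Yoneda embedding. The proof uses only the following
about `y`: it is fully faithful and dense, its comma categories `CostructuredArrow y X` are
`κ`-filtered, its values are `κ`-presentable, and `D` has pullbacks and `κ`-filtered colimits. These
facts hold because, as `C` has `κ`-small colimits, the `κ`-ind-objects are the presheaves sending
`κ`-small colimits to limits (`isCardinalIndObject_iff`). Filteredness of the comma categories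
implies that `y` preserves `κ`-small coproducts (`nonempty_isColimit_map_cofan`).

Extensivity is used in the form: squares `∐ A ⟶ ∐ X` induced by families `A i ⟶ X i` are pullbacks
(`CoproductSquaresArePullbacks`), and every morphism to `∐ X` is a coproduct of morphisms to the
`X i` (`MorphismsToCoproductsDecompose`).

The link between coproducts in `C` and in `D` is a presentation of an arbitrary coproduct `∐ X` in
`D` (`exists_stage_presentation`). A *stage* is a family of morphisms `y c_i ⟶ X i` in which `c_i`
is initial for all but a `κ`-small set of indices. Stages form a `κ`-filtered category, its
projections to the categories `CostructuredArrow y (X i)` are final, the coproduct `∐ c_i` exists in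
`C`, and `∐ X` is the colimit of the objects `y (∐ c_i)`.

If `C` is `κ`-extensive, then every morphism `y c ⟶ ∐ X` factors through a stage, and so does every
coincidence of two morphisms `y c ⟶ X i ⟶ ∐ X` and `y c ⟶ X i' ⟶ ∐ X`. Extensivity of `C` at that
stage shows that `∐ X` is a disjoint union locally for the topology of `κ`-small coproduct
decompositions of `c` (`isLocalDisjointUnion_of_isColimit`). Both extensivity conditions in `D`,
tested on the dense subcategory `C`, follow by gluing along such decompositions
(`isInfinitaryExtensive_of_isCardinalExtensive`).

Conversely, let `D` be `κ`-extensive. Pullback squares are reflected by `y`. A morphism to a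
`κ`-small coproduct in `C` decomposes in `D` as a coproduct of morphisms `A i ⟶ y (X i)` with
`∐ A = y Z`. As `y Z` is `κ`-presentable, it is a retract of `y (∐ c_i)` for a stage of `A`; since
coproduct squares are pullbacks, each `A i` is a retract of `y c_i`, and hence lies in `C`, where
idempotents split (`exists_iso_of_isColimit_cofan`).
-/

namespace KappaInd

/-! ### Extensivity in terms of arbitrary coproduct cofans -/

section CofanCriterion

variable {E : Type u} [Category.{v} E] {I : Type w}

/-- The coproduct squares of shape `I` are pullback squares: whenever `∐ A ⟶ ∐ X` is induced by
a family `A i ⟶ X i`, each `A i` is the pullback of `∐ A` along the injection of `X i`. -/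
def CoproductSquaresArePullbacks (E : Type u) [Category.{v} E] (I : Type w) : Prop :=
  ∀ ⦃X A : I → E⦄ (a : Cofan A) (p : Cofan X) (_ : IsColimit a) (_ : IsColimit p)
    (f : ∀ i, A i ⟶ X i) (g : a.pt ⟶ p.pt) (_ : ∀ i, a.inj i ≫ g = f i ≫ p.inj i) (i : I),
    IsPullback (a.inj i) (f i) g (p.inj i)

/-- Every morphism into a coproduct of shape `I` is, up to isomorphism, a coproduct of
morphisms into the summands. -/
def MorphismsToCoproductsDecompose (E : Type u) [Category.{v} E] (I : Type w) : Prop :=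
  ∀ ⦃X : I → E⦄ (p : Cofan X) (_ : IsColimit p) ⦃Z : E⦄ (g : Z ⟶ p.pt),
    ∃ (A : I → E) (f : ∀ i, A i ⟶ X i) (a : ∀ i, A i ⟶ Z),
      Nonempty (IsColimit (Cofan.mk Z a)) ∧ ∀ i, a i ≫ g = f i ≫ p.inj i

/-- The pullback condition makes the sum functors fully faithful, the decomposition condition makes
them essentially surjective. -/
lemma extensiveOfShape_of_pullbacks_of_decompose [h : HasCoproductsOfShape I E]
    (h₁ : CoproductSquaresArePullbacks E I) (h₂ : MorphismsToCoproductsDecompose E I) :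
    ExtensiveOfShape E I := by
  refine ⟨h, fun X => ?_⟩
  have hpb (A : ∀ i, Over (X i)) (i : I) :=
    h₁ (Cofan.mk _ (Sigma.ι fun i => (A i).left)) (Cofan.mk _ (Sigma.ι X))
      (coproductIsCoproduct _) (coproductIsCoproduct _) (fun i => (A i).hom)
      (Limits.Sigma.map (fun i => (A i).hom)) (by simp) i
  have : (sumFunctor X).Faithful := ⟨fun {A B} φ ψ hφ => by
    funext i
    ext
    apply (hpb B i).hom_ext
    · simpa [sumFunctor] using!
        Sigma.ι (fun i => (A i).left) i ≫= congr_arg CommaMorphism.left hφ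
    · simp⟩
  have : (sumFunctor X).Full := ⟨fun {A B} g => by
    let g' : (∐ fun i => (A i).left) ⟶ ∐ fun i => (B i).left := g.left
    have hg : g' ≫ Limits.Sigma.map (fun i => (B i).hom) =
      Limits.Sigma.map (fun i => (A i).hom) := Over.w g
    have w (i : I) : (Sigma.ι (fun i => (A i).left) i ≫ g') ≫
        Limits.Sigma.map (fun i => (B i).hom) = (A i).hom ≫ Sigma.ι X i := by
      rw [Category.assoc, hg]
      simp
    refine ⟨fun i => Over.homMk ((hpb B i).lift _ _ (w i)) ((hpb B i).lift_snd _ _ _), ?_⟩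
    ext
    refine Sigma.hom_ext _ _ fun i => ?_
    simp [sumFunctor, g']⟩
  have : (sumFunctor X).EssSurj := ⟨fun Z => by
    obtain ⟨A, f, a, ⟨ha⟩, hf⟩ := h₂ (Cofan.mk _ (Sigma.ι X)) (coproductIsCoproduct _) Z.hom
    let e : ∐ A ≅ Z.left := (coproductIsCoproduct A).coconePointUniqueUpToIso ha
    have he : e.hom ≫ Z.hom = Limits.Sigma.map f := Sigma.hom_ext _ _ fun i => by
      have : Sigma.ι A i ≫ e.hom = a i :=
        (coproductIsCoproduct A).comp_coconePointUniqueUpToIso_hom ha ⟨i⟩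
      simpa [reassoc_of% this] using hf i
    exact ⟨fun i => Over.mk (f i), ⟨Over.isoMk e he⟩⟩⟩
  exact {}

/-- An object `c` is the coproduct of the family which is `c` at `i` and initial elsewhere. -/
lemma exists_single [HasInitial E] (i : I) (c : E) :
    ∃ (A : I → E) (a : ∀ j, A j ⟶ c), Nonempty (IsColimit (Cofan.mk c a)) ∧ IsIso (a i) ∧
      ∀ j ≠ i, Nonempty (IsInitial (A j)) := by
  classical
  have key (j : I) : ∃ (B : E) (b : B ⟶ c), (j = i → IsIso b) ∧
      (j ≠ i → Nonempty (IsInitial B)) := by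
    by_cases h : j = i
    · exact ⟨c, 𝟙 c, fun _ => inferInstance, fun h' => (h' h).elim⟩
    · exact ⟨⊥_ E, initial.to c, fun h' => (h h').elim, fun _ => ⟨initialIsInitial⟩⟩
  choose A a h₁ h₂ using key
  have := h₁ i rfl
  refine ⟨A, a, ⟨Cofan.IsColimit.mk _ (fun t => inv (a i) ≫ t.inj i) (fun t j => ?_)
    (fun t m hm => ?_)⟩, this, h₂⟩
  · by_cases h : j = i
    · subst h
      simp
    · exact (h₂ j h).some.hom_ext _ _
  · simp [← hm]

lemma exists_family_hom {A X : I → E} (i : I) (hA : ∀ j ≠ i, Nonempty (IsInitial (A j)))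
    (f : A i ⟶ X i) : ∃ g : ∀ j, A j ⟶ X j, g i = f := by
  classical
  exact ⟨Function.update (fun j => if h : j = i then h ▸ f else (hA j h).some.to _) i f,
    Function.update_self ..⟩

section

variable (h : ExtensiveOfShape E I)

include h in
lemma ExtensiveOfShape.decompose : MorphismsToCoproductsDecompose E I := by
  obtain ⟨_, h⟩ := h
  intro X p hp Z g
  have := h X
  let e := hp.coconePointUniqueUpToIso (coproductIsCoproduct X)
  have he (i : I) : p.inj i ≫ e.hom = Sigma.ι X i :=
    hp.comp_coconePointUniqueUpToIso_hom (coproductIsCoproduct X) ⟨i⟩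
  let A := (sumFunctor X).objPreimage (Over.mk (g ≫ e.hom))
  let φ := (sumFunctor X).objObjPreimageIso (Over.mk (g ≫ e.hom))
  let ψ : ∐ (fun i => (A i).left) ≅ Z := (Over.forget _).mapIso φ
  have hψ : ψ.hom ≫ g ≫ e.hom = Limits.Sigma.map (fun i => (A i).hom) := Over.w φ.hom
  refine ⟨fun i => (A i).left, fun i => (A i).hom, fun i => Sigma.ι (fun i => (A i).left) i ≫ ψ.hom,
    ⟨(coproductIsCoproduct fun i => (A i).left).ofIsoColimit (Cofan.ext ψ fun i => rfl)⟩,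
    fun i => ?_⟩
  rw [← cancel_mono e.hom]
  simp [hψ, he]

end

/-- Fullness of the sum functor, expressed for arbitrary coproduct cofans. -/
lemma exists_family_of_full [HasCoproductsOfShape I E] {X A B : I → E} [(sumFunctor X).Full]
    {a : Cofan A} {b : Cofan B} {p : Cofan X} (ha : IsColimit a) (hb : IsColimit b)
    (hp : IsColimit p) (f : ∀ i, A i ⟶ X i) (f' : ∀ i, B i ⟶ X i)
    (g : b.pt ⟶ p.pt) (hg : ∀ i, b.inj i ≫ g = f' i ≫ p.inj i) (φ : a.pt ⟶ b.pt)
    (hφ : ∀ i, a.inj i ≫ φ ≫ g = f i ≫ p.inj i) :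
    ∃ ψ : ∀ i, A i ⟶ B i, ∀ i, ψ i ≫ f' i = f i ∧ ψ i ≫ b.inj i = a.inj i ≫ φ := by
  let ea : ∐ A ≅ a.pt := (coproductIsCoproduct A).coconePointUniqueUpToIso ha
  let eb : ∐ B ≅ b.pt := (coproductIsCoproduct B).coconePointUniqueUpToIso hb
  let ep : ∐ X ≅ p.pt := (coproductIsCoproduct X).coconePointUniqueUpToIso hp
  have hea (i : I) : Sigma.ι A i ≫ ea.hom = a.inj i :=
    (coproductIsCoproduct A).comp_coconePointUniqueUpToIso_hom ha ⟨i⟩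
  have heb (i : I) : Sigma.ι B i ≫ eb.hom = b.inj i :=
    (coproductIsCoproduct B).comp_coconePointUniqueUpToIso_hom hb ⟨i⟩
  have hep (i : I) : Sigma.ι X i ≫ ep.hom = p.inj i :=
    (coproductIsCoproduct X).comp_coconePointUniqueUpToIso_hom hp ⟨i⟩
  have hg' : eb.hom ≫ g = Limits.Sigma.map f' ≫ ep.hom :=
    Sigma.hom_ext _ _ fun i => by simp [reassoc_of% heb, hep, hg]
  have hφ' : (ea.hom ≫ φ ≫ eb.inv) ≫ Limits.Sigma.map f' = Limits.Sigma.map f := by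
    rw [← cancel_mono ep.hom]
    refine Sigma.hom_ext _ _ fun i => ?_
    simp [← hg', reassoc_of% hea, hep, hφ]
  obtain ⟨ψ, hψ⟩ := (sumFunctor X).map_surjective
    (X := fun i => Over.mk (f i)) (Y := fun i => Over.mk (f' i)) (Over.homMk _ hφ')
  have hψ' : Limits.Sigma.map (fun i => (ψ i).left) = ea.hom ≫ φ ≫ eb.inv :=
    congr_arg CommaMorphism.left hψ
  refine ⟨fun i => (ψ i).left, fun i => ⟨Over.w (ψ i), ?_⟩⟩
  have := Sigma.ι A i ≫= hψ' =≫ eb.hom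
  simpa [heb, reassoc_of% hea] using this

/-- Faithfulness of the sum functor, expressed for arbitrary coproduct cofans. -/
lemma family_ext_of_faithful [HasCoproductsOfShape I E] {X A B : I → E} [(sumFunctor X).Faithful]
    {b : Cofan B} (hb : IsColimit b) (f' : ∀ i, B i ⟶ X i) {ψ ψ' : ∀ i, A i ⟶ B i}
    (h₁ : ∀ i, ψ i ≫ f' i = ψ' i ≫ f' i) (h₂ : ∀ i, ψ i ≫ b.inj i = ψ' i ≫ b.inj i) :
    ψ = ψ' := by
  let eb : ∐ B ≅ b.pt := (coproductIsCoproduct B).coconePointUniqueUpToIso hb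
  have heb (i : I) : Sigma.ι B i ≫ eb.hom = b.inj i :=
    (coproductIsCoproduct B).comp_coconePointUniqueUpToIso_hom hb ⟨i⟩
  let F (i : I) : Over.mk (ψ i ≫ f' i) ⟶ Over.mk (f' i) := Over.homMk (ψ i)
  let F' (i : I) : Over.mk (ψ i ≫ f' i) ⟶ Over.mk (f' i) := Over.homMk (ψ' i) (h₁ i).symm
  have h : Limits.Sigma.map ψ = Limits.Sigma.map ψ' := by
    rw [← cancel_mono eb.hom]
    exact Sigma.hom_ext _ _ fun i => by simp [heb, h₂]
  have : F = F' := (sumFunctor X).map_injective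
    (X := fun i => Over.mk (ψ i ≫ f' i)) (Y := fun i => Over.mk (f' i))
    (Over.OverMorphism.ext h)
  funext i
  exact congr_arg CommaMorphism.left (congr_fun this i)

/-- The morphisms `c ⟶ ∐ B` lying over an injection `X i ⟶ ∐ X` are identified with the morphisms
`c ⟶ B i` over `X i` by applying full faithfulness of the sum functor to the family which is `c`
at `i` and initial elsewhere. -/
lemma ExtensiveOfShape.pullbacks [HasInitial E] (h : ExtensiveOfShape E I) :
    CoproductSquaresArePullbacks E I := by
  obtain ⟨_, h⟩ := h
  intro X B b p hb hp f' g hg i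
  have := h X
  have hex (s : PullbackCone g (p.inj i)) :
      ∃ l : s.pt ⟶ B i, l ≫ b.inj i = s.fst ∧ l ≫ f' i = s.snd := by
    obtain ⟨A, a, ⟨ha⟩, _, hA⟩ := exists_single i s.pt
    obtain ⟨f, hf⟩ := exists_family_hom i hA (a i ≫ s.snd)
    obtain ⟨ψ, hψ⟩ := exists_family_of_full ha hb hp f f' g hg s.fst (fun j => by
      by_cases hj : j = i
      · subst hj
        simp [hf, s.condition]
      · exact (hA j hj).some.hom_ext _ _)
    exact ⟨inv (a i) ≫ ψ i, by simp [(hψ i).2], by simp [(hψ i).1, hf]⟩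
  have huniq {c : E} (l l' : c ⟶ B i) (h₁ : l ≫ b.inj i = l' ≫ b.inj i)
      (h₂ : l ≫ f' i = l' ≫ f' i) : l = l' := by
    obtain ⟨A, a, ⟨ha⟩, _, hA⟩ := exists_single i c
    obtain ⟨ψ, hψ⟩ := exists_family_hom i hA (a i ≫ l)
    obtain ⟨ψ', hψ'⟩ := exists_family_hom i hA (a i ≫ l')
    have : ψ = ψ' := by
      refine family_ext_of_faithful hb f' (fun j => ?_) (fun j => ?_) <;>
      · by_cases hj : j = i
        · subst hj
          simp [hψ, hψ', h₁, h₂]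
        · exact (hA j hj).some.hom_ext _ _
    rw [← cancel_epi (a i), ← hψ, ← hψ', this]
  choose l hl₁ hl₂ using hex
  exact ⟨⟨hg i⟩, ⟨PullbackCone.IsLimit.mk _ l hl₁ hl₂ fun s m hm₁ hm₂ =>
    huniq _ _ (by rw [hm₁, hl₁]) (by rw [hm₂, hl₂])⟩⟩

section

variable (h : CoproductSquaresArePullbacks E I) {X : I → E} {p : Cofan X} (hp : IsColimit p)

include h hp in
/-- If `x` and `x'` have the same composition with the injection of `X i`, then `x'` factors through
`c` as the pullback of `c ⟶ ∐ X` along this injection, which forces `x' = x`. -/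
lemma CoproductSquaresArePullbacks.mono_inj [HasInitial E] (i : I) : Mono (p.inj i) := by
  refine ⟨fun {c} x x' hx => ?_⟩
  obtain ⟨A, a, ⟨ha⟩, _, hA⟩ := exists_single i c
  obtain ⟨f, hf⟩ := exists_family_hom i hA (a i ≫ x)
  have sq := h _ p ha hp f (x ≫ p.inj i) (fun j => by
    by_cases hj : j = i
    · subst hj
      simp [hf]
    · exact (hA j hj).some.hom_ext _ _) i
  let l : c ⟶ A i := sq.lift (𝟙 c) x' (by simpa using hx)
  have hl : l ≫ a i = 𝟙 c := sq.lift_fst (𝟙 c) x' (by simpa using hx)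
  have hl' : l ≫ f i = x' := sq.lift_snd (𝟙 c) x' (by simpa using hx)
  rw [← hl', hf, reassoc_of% hl]

include h hp in
/-- The summands of a coproduct are disjoint. -/
lemma CoproductSquaresArePullbacks.isInitial_of_comp_inj_eq [HasInitial E] {i j : I} (hij : i ≠ j)
    {c : E} (x : c ⟶ X i) (x' : c ⟶ X j) (hx : x ≫ p.inj i = x' ≫ p.inj j) :
    Nonempty (IsInitial c) := by
  obtain ⟨A, a, ⟨ha⟩, _, hA⟩ := exists_single i c
  obtain ⟨f, hf⟩ := exists_family_hom i hA (a i ≫ x)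
  have sq := h _ p ha hp f (x ≫ p.inj i) (fun j => by
    by_cases hj : j = i
    · subst hj
      simp [hf]
    · exact (hA j hj).some.hom_ext _ _) j
  let l : c ⟶ A j := sq.lift (𝟙 c) x' (by simpa using hx)
  have hl : l ≫ a j = 𝟙 c := sq.lift_fst (𝟙 c) x' (by simpa using hx)
  obtain ⟨hAj⟩ := hA j hij.symm
  -- `c` is a retract of the initial object `A j`
  exact ⟨IsInitial.ofUniqueHom (fun Y => l ≫ hAj.to Y) fun Y m => by
    rw [hAj.hom_ext (hAj.to Y) (a j ≫ m), reassoc_of% hl]⟩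

end

end CofanCriterion

/-! ### Dense functors, filtered comma categories and small coproducts -/

section Dense

variable {C : Type w} [Category.{w} C] {D : Type u} [Category.{w} D] (y : C ⥤ D)

/-- The canonical diagram of objects `y.obj c` over `X`, as a cocone with point `X`. -/
def canonicalCocone (X : D) : Cocone (CostructuredArrow.proj y X ⋙ y) where
  pt := X
  ι := { app e := e.hom
         naturality _ _ φ := (CostructuredArrow.w φ).trans (Category.comp_id _).symm }

/-- For a dense functor, every object is the colimit of its canonical diagram. -/
noncomputable def isColimitCanonicalCocone [y.IsDense] (X : D) :
    IsColimit (canonicalCocone y X) :=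
  IsColimit.ofIsoColimit (y.denseAt X) (Cocone.ext (Iso.refl _)
    fun _ => (Category.comp_id _).trans (Category.id_comp _))

variable {y} [y.IsDense]

lemma hom_ext_of_isDense {X Y : D} {f g : X ⟶ Y}
    (h : ∀ (c : C) (x : y.obj c ⟶ X), x ≫ f = x ≫ g) : f = g :=
  (isColimitCanonicalCocone y X).hom_ext fun e => h _ e.hom

/-- Morphisms out of `X` can be defined on the objects in the image of a dense functor. -/
lemma exists_hom_of_isDense {X Y : D} (φ : ∀ c : C, (y.obj c ⟶ X) → (y.obj c ⟶ Y))
    (hφ : ∀ (c c' : C) (f : c ⟶ c') (x : y.obj c' ⟶ X), y.map f ≫ φ c' x = φ c (y.map f ≫ x)) :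
    ∃ g : X ⟶ Y, ∀ (c : C) (x : y.obj c ⟶ X), x ≫ g = φ c x := by
  let t : Cocone (CostructuredArrow.proj y X ⋙ y) :=
    { pt := Y
      ι := { app e := φ _ e.hom
             naturality e e' f := (hφ _ _ f.left e'.hom).trans
              ((congr_arg (φ _) (CostructuredArrow.w f)).trans (Category.comp_id _).symm) } }
  exact ⟨(isColimitCanonicalCocone y X).desc t,
    fun c x => (isColimitCanonicalCocone y X).fac t (CostructuredArrow.mk x)⟩

/-- Pullback squares can be tested on the objects in the image of a dense functor. -/
lemma isPullback_of_isDense {P X Y Z : D} {fst : P ⟶ X} {snd : P ⟶ Y} {f : X ⟶ Z} {g : Y ⟶ Z}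
    (w : fst ≫ f = snd ≫ g)
    (hex : ∀ (c : C) (a : y.obj c ⟶ X) (b : y.obj c ⟶ Y), a ≫ f = b ≫ g →
      ∃ l : y.obj c ⟶ P, l ≫ fst = a ∧ l ≫ snd = b)
    (huniq : ∀ (c : C) (l l' : y.obj c ⟶ P), l ≫ fst = l' ≫ fst → l ≫ snd = l' ≫ snd → l = l') :
    IsPullback fst snd f g := by
  have hlift (s : PullbackCone f g) : ∃ l : s.pt ⟶ P, l ≫ fst = s.fst ∧ l ≫ snd = s.snd := by
    choose l hl₁ hl₂ using fun (c : C) (x : y.obj c ⟶ s.pt) =>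
      hex c (x ≫ s.fst) (x ≫ s.snd) (by simp [s.condition])
    obtain ⟨m, hm⟩ := exists_hom_of_isDense l fun c c' f x =>
      huniq _ _ _ (by simp [hl₁]) (by simp [hl₂])
    exact ⟨m, hom_ext_of_isDense (y := y) fun c x => by rw [← Category.assoc, hm, hl₁],
      hom_ext_of_isDense (y := y) fun c x => by rw [← Category.assoc, hm, hl₂]⟩
  choose l hl₁ hl₂ using hlift
  refine ⟨⟨w⟩, ⟨PullbackCone.IsLimit.mk _ l hl₁ hl₂ fun s m hm₁ hm₂ => ?_⟩⟩
  refine hom_ext_of_isDense (y := y) fun c x => huniq _ _ _ ?_ ?_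
  · simp [hm₁, hl₁]
  · simp [hm₂, hl₂]

/-- Isomorphisms can be tested on the objects in the image of a dense functor. -/
lemma isIso_of_isDense {X Y : D} (f : X ⟶ Y)
    (hf : ∀ c : C, Function.Bijective fun x : y.obj c ⟶ X => x ≫ f) : IsIso f := by
  have : IsPullback f f (𝟙 Y) (𝟙 Y) := isPullback_of_isDense (y := y) rfl
    (fun c a b hab => by
      obtain ⟨l, hl⟩ := (hf c).2 a
      simp only [Category.comp_id] at hab
      exact ⟨l, hl, hab ▸ hl⟩)
    (fun c l l' h _ => (hf c).1 h)
  exact this.isIso_fst_of_isIso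

end Dense

section Filtered

open IsCardinalFiltered

variable {C : Type w} [Category.{w} C] {D : Type u} [Category.{w} D] (y : C ⥤ D)
  (κ : Cardinal.{w}) [Fact κ.IsRegular] [∀ X, IsCardinalFiltered (CostructuredArrow y X) κ]

/-- A functor with `κ`-filtered comma categories preserves `κ`-small coproducts: a `κ`-small family
of morphisms `y.obj (x s) ⟶ W` factors through a single object of `C` over `W`. -/
lemma nonempty_isColimit_map_cofan {S : Type w} (hS : HasCardinalLT S κ) {x : S → C}
    {p : Cofan x} (hp : IsColimit p) :
    Nonempty (IsColimit (Cofan.mk (f := fun s => y.obj (x s)) (y.obj p.pt)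
      fun s => y.map (p.inj s))) := by
  have hdesc (t : Cofan fun s => y.obj (x s)) :
      ∃ d : y.obj p.pt ⟶ t.pt, ∀ s, y.map (p.inj s) ≫ d = t.inj s := by
    let e (s : S) : CostructuredArrow y t.pt := CostructuredArrow.mk (t.inj s)
    let d : p.pt ⟶ (max e hS).left := Cofan.IsColimit.desc hp fun s => (toMax e hS s).left
    refine ⟨y.map d ≫ (max e hS).hom, fun s => ?_⟩
    rw [← y.map_comp_assoc, Cofan.IsColimit.fac]
    exact CostructuredArrow.w (toMax e hS s)
  have huniq {W : D} (m m' : y.obj p.pt ⟶ W)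
      (h : ∀ s, y.map (p.inj s) ≫ m = y.map (p.inj s) ≫ m') : m = m' := by
    have := isFiltered_of_isCardinalFiltered (CostructuredArrow y W) κ
    let M := IsFiltered.max (CostructuredArrow.mk m) (CostructuredArrow.mk m')
    let u : CostructuredArrow.mk m ⟶ M := IsFiltered.leftToMax _ _
    let u' : CostructuredArrow.mk m' ⟶ M := IsFiltered.rightToMax _ _
    have hu : y.map u.left ≫ M.hom = m := CostructuredArrow.w u
    have hu' : y.map u'.left ≫ M.hom = m' := CostructuredArrow.w u'
    have hcoeq (s : S) : ∃ (N : CostructuredArrow y W) (q : M ⟶ N),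
        p.inj s ≫ u.left ≫ q.left = p.inj s ≫ u'.left ≫ q.left := by
      let v : CostructuredArrow.mk (y.map (p.inj s) ≫ m) ⟶ M :=
        CostructuredArrow.homMk (p.inj s ≫ u.left) (by simp [hu])
      let v' : CostructuredArrow.mk (y.map (p.inj s) ≫ m) ⟶ M :=
        CostructuredArrow.homMk (p.inj s ≫ u'.left) (by simp [hu', h])
      refine ⟨IsFiltered.coeq v v', IsFiltered.coeqHom v v', ?_⟩
      simpa [v, v'] using congr_arg CommaMorphism.left (IsFiltered.coeq_condition v v')
    choose N q hq using hcoeq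
    obtain ⟨K, a, b, hab⟩ := wideSpan q hS
    have hb : u.left ≫ b.left = u'.left ≫ b.left :=
      Cofan.IsColimit.hom_ext hp _ _ fun s => by
        simp [← hab s, reassoc_of% hq s]
    rw [← hu, ← hu', ← CostructuredArrow.w b, ← y.map_comp_assoc, hb, y.map_comp_assoc]
  choose d hd using hdesc
  exact ⟨Cofan.IsColimit.mk _ d hd fun t m hm => huniq _ _ fun s => by rw [hd]; exact hm s⟩

include κ in
lemma nonempty_isInitial_map {c : C} (hc : IsInitial c) : Nonempty (IsInitial (y.obj c)) := by
  have hS : HasCardinalLT PEmpty.{w + 1} κ :=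
    hasCardinalLT_of_finite _ _ (Cardinal.IsRegular.aleph0_le Fact.out)
  obtain ⟨h⟩ := nonempty_isColimit_map_cofan y κ hS
    (p := Cofan.mk (f := (PEmpty.elim : PEmpty.{w + 1} → C)) c (fun s => s.elim))
    (Cofan.IsColimit.mk _ (fun t => hc.to _) (fun _ s => s.elim) fun _ _ _ => hc.hom_ext _ _)
  exact ⟨IsInitial.ofUniqueHom (fun Y => Cofan.IsColimit.desc h fun s => s.elim)
    fun Y m => Cofan.IsColimit.hom_ext h _ _ fun s => s.elim⟩

include κ in
lemma nonempty_isInitial_costructuredArrow {X : D} (e : CostructuredArrow y X)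
    (he : IsInitial e.left) : Nonempty (IsInitial e) := by
  obtain ⟨h⟩ := nonempty_isInitial_map y κ he
  exact ⟨IsInitial.ofUniqueHom (fun e' => CostructuredArrow.homMk (he.to _) (h.hom_ext _ _))
    fun e' m => CostructuredArrow.hom_ext _ _ (he.hom_ext _ _)⟩

end Filtered

section Restrict

variable {C : Type u} [Category.{v} C]

/-- A coproduct only depends on the summands which are not initial. -/
lemma nonempty_isColimit_cofan_iff_restrict {I : Type w} {x : I → C} (S : Set I)
    (hS : ∀ i ∉ S, Nonempty (IsInitial (x i))) (p : Cofan x) :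
    Nonempty (IsColimit p) ↔
      Nonempty (IsColimit (Cofan.mk (f := fun s : S => x s) p.pt fun s => p.inj s)) := by
  classical
  have hext (t : Cofan fun s : S => x s) : ∃ t' : ∀ i, x i ⟶ t.pt, ∀ s : S, t' s = t.inj s :=
    ⟨fun i => if h : i ∈ S then t.inj ⟨i, h⟩ else (hS i h).some.to _, fun s => by simp⟩
  constructor
  · rintro ⟨hp⟩
    choose t' ht' using hext
    refine ⟨Cofan.IsColimit.mk _ (fun t => Cofan.IsColimit.desc hp (t' t))
      (fun t s => ?_) fun t m hm => Cofan.IsColimit.hom_ext hp _ _ fun i => ?_⟩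
    · exact (Cofan.IsColimit.fac hp (t' t) s).trans (ht' t s)
    · by_cases hi : i ∈ S
      · rw [Cofan.IsColimit.fac, ht' t ⟨i, hi⟩]
        exact hm ⟨i, hi⟩
      · exact (hS i hi).some.hom_ext _ _
  · rintro ⟨hp⟩
    refine ⟨Cofan.IsColimit.mk _ (fun t => Cofan.IsColimit.desc hp fun s => t.inj s)
      (fun t i => ?_) fun t m hm => Cofan.IsColimit.hom_ext hp _ _ fun s => ?_⟩
    · by_cases hi : i ∈ S
      · exact Cofan.IsColimit.fac hp (fun s => t.inj s) ⟨i, hi⟩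
      · exact (hS i hi).some.hom_ext _ _
    · rw [Cofan.IsColimit.fac]
      exact hm s

lemma hasCoproduct_of_restrict {I : Type w} (x : I → C) (S : Set I)
    (hS : ∀ i ∉ S, Nonempty (IsInitial (x i))) [HasCoproduct fun s : S => x s] :
    HasCoproduct x := by
  classical
  let p : Cofan x := Cofan.mk (∐ fun s : S => x s) fun i =>
    if h : i ∈ S then Sigma.ι (fun s : S => x s) ⟨i, h⟩ else (hS i h).some.to _
  obtain ⟨hp⟩ := (nonempty_isColimit_cofan_iff_restrict S hS p).2
    ⟨(coproductIsCoproduct fun s : S => x s).ofIsoColimit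
      (Cofan.ext (Iso.refl _) fun s => by simp [p])⟩
  exact ⟨⟨_, hp⟩⟩

end Restrict

/-! ### The category of stages of a family -/

section StageCategory

variable {C : Type w} [Category.{w} C] {D : Type u} [Category.{w} D] (y : C ⥤ D)
  (κ : Cardinal.{w}) {I : Type w} (X : I → D)

/-- The families of objects of `C` over the members of a family `X` which are initial outside of a
`κ`-small set of indices. -/
def smallSupport : ObjectProperty (∀ i, CostructuredArrow y (X i)) := fun e =>
  ∃ S : Set I, HasCardinalLT S κ ∧ ∀ i ∉ S, Nonempty (IsInitial (e i).left)

/-- The indexing category for the presentation of `∐ X` as a colimit of objects of `C`: an object is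
a family `e i : y.obj c_i ⟶ X i` with `c_i` initial outside of a `κ`-small set of indices. -/
abbrev Stage := (smallSupport y κ X).FullSubcategory

/-- The projection sending a stage to its component at `i`. -/
def stageEval (i : I) : Stage y κ X ⥤ CostructuredArrow y (X i) :=
  (smallSupport y κ X).ι ⋙ Pi.eval _ i

variable {κ X} in
lemma hasCoproduct_stage (hC : ∀ S : Type w, HasCardinalLT S κ → HasCoproductsOfShape S C)
    (j : Stage y κ X) : HasCoproduct fun i => (j.obj i).left := by
  obtain ⟨S, hS, h⟩ := j.property
  have := hC S hS
  exact hasCoproduct_of_restrict _ S h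

section

variable [h : ∀ j : Stage y κ X, HasCoproduct fun i => (j.obj i).left]

/-- The functor sending a stage to the coproduct of its components. -/
noncomputable def stageCoproduct : Stage y κ X ⥤ C where
  obj j := ∐ fun i => (j.obj i).left
  map f := Limits.Sigma.map fun i => (f.hom i).left
  map_id j := Sigma.hom_ext _ _ fun i => by simp
  map_comp f g := Sigma.hom_ext _ _ fun i => by simp

variable {y κ X}

/-- The injection of a component of a stage into its coproduct. -/
noncomputable def stageι (j : Stage y κ X) (i : I) :
    (j.obj i).left ⟶ (stageCoproduct y κ X).obj j :=
  Sigma.ι (fun i => (j.obj i).left) i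

/-- The coproduct attached to a stage, as a colimit cofan. -/
noncomputable def isColimitStageι (j : Stage y κ X) :
    IsColimit (Cofan.mk ((stageCoproduct y κ X).obj j) (stageι j)) :=
  coproductIsCoproduct _

lemma stageι_map {j j' : Stage y κ X} (f : j ⟶ j') (i : I) :
    stageι j i ≫ (stageCoproduct y κ X).map f = (f.hom i).left ≫ stageι j' i := by
  simp [stageCoproduct, stageι]

end

variable [Fact κ.IsRegular] [∀ X, IsCardinalFiltered (CostructuredArrow y X) κ] [HasInitial C]

/-- The object of `CostructuredArrow y Z` given by the initial object of `C`. -/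
noncomputable def botOver (Z : D) : CostructuredArrow y Z :=
  CostructuredArrow.mk ((nonempty_isInitial_map y κ (initialIsInitial (C := C))).some.to Z)

/-- Cocones over `κ`-small diagrams of stages are constructed componentwise. Outside of the
`κ`-small union of the supports, the component of the cocone point is taken to be initial. -/
instance : IsCardinalFiltered (Stage y κ X) κ where
  nonempty_cocone {A _} F hA := by
    choose S hS hF using fun a => (F.obj a).property
    let U := ⋃ a, S a
    have key (i : I) : ∃ c : Cocone (F ⋙ stageEval y κ X i),
        i ∉ U → Nonempty (IsInitial c.pt.left) := by
      by_cases hi : i ∈ U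
      · exact ⟨IsCardinalFiltered.cocone _ hA, fun h => (h hi).elim⟩
      · have hin (a : A) : IsInitial ((F ⋙ stageEval y κ X i).obj a) :=
          (nonempty_isInitial_costructuredArrow y κ _
            (hF a i fun h => hi (Set.mem_iUnion.2 ⟨a, h⟩)).some).some
        exact ⟨⟨botOver y κ (X i), { app a := (hin a).to _
                                     naturality a b f := (hin a).hom_ext _ _ }⟩,
          fun _ => ⟨initialIsInitial⟩⟩
    choose c hc using key
    exact ⟨{
      pt := ⟨fun i => (c i).pt, U,
        hasCardinalLT_iUnion _ (hasCardinalLT_of_hasCardinalLT_arrow hA) hS, hc⟩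
      ι :=
        { app a := ObjectProperty.homMk fun i => (c i).ι.app a
          naturality a b f := by
            ext : 1
            funext i
            exact (c i).ι.naturality f } }⟩

/-- The projections from stages are final: any component at `i` can be prescribed, the others being
initial. -/
instance (i : I) : (stageEval y κ X i).Final := by
  classical
  have := isFiltered_of_isCardinalFiltered (Stage y κ X) κ
  refine Functor.final_of_exists_of_isFiltered _ (fun d => ?_) fun {d j} s s' => ?_
  · let e : ∀ j, CostructuredArrow y (X j) := Function.update (fun j => botOver y κ (X j)) i d
    have hd : e i = d := Function.update_self ..
    refine ⟨⟨e, {i}, hasCardinalLT_of_finite _ _ (Cardinal.IsRegular.aleph0_le Fact.out),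
      fun j hj => ?_⟩, ⟨eqToHom hd.symm⟩⟩
    have he : e j = botOver y κ (X j) := Function.update_of_ne (by simpa using hj) ..
    rw [he]
    exact ⟨initialIsInitial⟩
  · have := isFiltered_of_isCardinalFiltered (CostructuredArrow y (X i)) κ
    -- only the component at `i` has to be moved
    let t : ∀ k, Σ e, (j.obj k ⟶ e) := Function.update (fun k => ⟨_, 𝟙 _⟩) i
      ⟨_, IsFiltered.coeqHom s s'⟩
    have ht : t i = ⟨_, IsFiltered.coeqHom s s'⟩ := Function.update_self ..
    obtain ⟨S, hS, hj⟩ := j.property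
    refine ⟨⟨fun k => (t k).1, insert i S, ?_, fun k hk => ?_⟩,
      ObjectProperty.homMk fun k => (t k).2, ?_⟩
    · rw [Set.insert_eq]
      have := Cardinal.IsRegular.aleph0_le (c := κ) Fact.out
      exact hasCardinalLT_union this (hasCardinalLT_of_finite _ _ this) hS
    · have : t k = ⟨_, 𝟙 _⟩ := Function.update_of_ne (fun h => hk (by simp [h])) ..
      dsimp only
      rw [this]
      exact hj k fun h => hk (by simp [h])
    · have (p : Σ e, (j.obj i ⟶ e)) (hp : p = ⟨_, IsFiltered.coeqHom s s'⟩) :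
          s ≫ p.2 = s' ≫ p.2 := by
        subst hp
        exact IsFiltered.coeq_condition s s'
      exact this _ ht

end StageCategory

/-! ### Coproducts as colimits over stages -/

section StageColimit

variable {C : Type w} [Category.{w} C] {D : Type u} [Category.{w} D] (y : C ⥤ D)
  (κ : Cardinal.{w}) [Fact κ.IsRegular] [∀ X, IsCardinalFiltered (CostructuredArrow y X) κ]
  {I : Type w} (X : I → D) [∀ j : Stage y κ X, HasCoproduct fun i => (j.obj i).left]

variable {X} in
/-- The coproduct attached to a stage is preserved by `y`: it is a `κ`-small coproduct up to initial
summands. -/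
lemma nonempty_isColimit_map_stageCoproduct (j : Stage y κ X) :
    Nonempty (IsColimit (Cofan.mk (f := fun i => y.obj (j.obj i).left)
      (y.obj ((stageCoproduct y κ X).obj j)) fun i => y.map (stageι j i))) := by
  obtain ⟨S, hS, h⟩ := j.property
  obtain ⟨hp⟩ := (nonempty_isColimit_cofan_iff_restrict S h
    _).1 ⟨isColimitStageι j⟩
  exact (nonempty_isColimit_cofan_iff_restrict S
    (fun i hi => nonempty_isInitial_map y κ (h i hi).some)
    (Cofan.mk _ fun i => y.map (stageι j i))).2 (nonempty_isColimit_map_cofan y κ hS hp)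

variable [HasInitial C] [y.IsDense] [HasCardinalFilteredColimits D κ]

/-- The coproduct of `X` exists in `D` and can be computed as the colimit of the objects
`y.obj (∐ c_i)` over the stages. The injection of `X i` is defined on its canonical diagram, which
may be indexed by the stages since `stageEval y κ X i` is final. -/
lemma exists_stage_cofan : ∃ (t : Cocone (stageCoproduct y κ X ⋙ y)) (p : ∀ i, X i ⟶ t.pt),
    Nonempty (IsColimit t) ∧ Nonempty (IsColimit (Cofan.mk t.pt p)) ∧
      ∀ j i, (j.obj i).hom ≫ p i = y.map (stageι j i) ≫ t.ι.app j := by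
  have := HasCardinalFilteredColimits.hasColimitsOfShape D κ (Stage y κ X)
  let t := colimit.cocone (stageCoproduct y κ X ⋙ y)
  let ht : IsColimit t := colimit.isColimit _
  have hw {j j' : Stage y κ X} (f : j ⟶ j') :
      y.map ((stageCoproduct y κ X).map f) ≫ t.ι.app j' = t.ι.app j := t.w f
  let hX (i : I) : IsColimit ((canonicalCocone y (X i)).whisker (stageEval y κ X i)) :=
    (Functor.Final.isColimitWhiskerEquiv _ _).symm (isColimitCanonicalCocone y (X i))
  have hext (i : I) {W : D} (m m' : X i ⟶ W)
      (h : ∀ j : Stage y κ X, (j.obj i).hom ≫ m = (j.obj i).hom ≫ m') : m = m' :=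
    (hX i).hom_ext h
  have hc (i : I) {j j' : Stage y κ X} (f : j ⟶ j') :
      y.map (f.hom i).left ≫ y.map (stageι j' i) ≫ t.ι.app j' = y.map (stageι j i) ≫ t.ι.app j := by
    rw [← hw f, ← y.map_comp_assoc, ← y.map_comp_assoc, stageι_map]
  have hp (i : I) : ∃ p : X i ⟶ t.pt, ∀ j : Stage y κ X,
      (j.obj i).hom ≫ p = y.map (stageι j i) ≫ t.ι.app j := by
    let c : Cocone (stageEval y κ X i ⋙ CostructuredArrow.proj y (X i) ⋙ y) :=
      { pt := t.pt
        ι := { app j := y.map (stageι j i) ≫ t.ι.app j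
               naturality j j' f := (hc i f).trans (Category.comp_id _).symm } }
    exact ⟨(hX i).desc c, fun j => (hX i).fac c j⟩
  choose p hp using hp
  have hL (j : Stage y κ X) := (nonempty_isColimit_map_stageCoproduct y κ j).some
  have hLext (j : Stage y κ X) {W : D} (m m' : y.obj ((stageCoproduct y κ X).obj j) ⟶ W)
      (h : ∀ i, y.map (stageι j i) ≫ m = y.map (stageι j i) ≫ m') : m = m' :=
    Cofan.IsColimit.hom_ext (hL j) _ _ h
  have hLd (W : Cofan X) (j : Stage y κ X) : ∃ d : y.obj ((stageCoproduct y κ X).obj j) ⟶ W.pt,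
      ∀ i, y.map (stageι j i) ≫ d = (j.obj i).hom ≫ W.inj i :=
    ⟨Cofan.IsColimit.desc (hL j) _, Cofan.IsColimit.fac (hL j) _⟩
  choose d hd using hLd
  have hnat (W : Cofan X) {j j' : Stage y κ X} (f : j ⟶ j') :
      y.map ((stageCoproduct y κ X).map f) ≫ d W j' = d W j := hLext j _ _ fun i => by
    rw [hd, ← y.map_comp_assoc, stageι_map, y.map_comp_assoc, hd, CostructuredArrow.w_assoc]
  have hdesc (W : Cofan X) : ∃ m : t.pt ⟶ W.pt, ∀ j, t.ι.app j ≫ m = d W j := by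
    let c : Cocone (stageCoproduct y κ X ⋙ y) :=
      { pt := W.pt
        ι := { app j := d W j
               naturality j j' f := (hnat W f).trans (Category.comp_id _).symm } }
    exact ⟨ht.desc c, fun j => ht.fac c j⟩
  choose m hm using hdesc
  refine ⟨t, p, ⟨ht⟩, ⟨Cofan.IsColimit.mk _ m (fun W i => hext i _ _ fun j => ?_)
    fun W m' hm' => ht.hom_ext fun j => hLext j _ _ fun i => ?_⟩, fun j i => hp i j⟩
  · change _ ≫ p i ≫ m W = _
    rw [reassoc_of% hp, hm, hd]
  · change ∀ i, p i ≫ m' = _ at hm'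
    change _ ≫ t.ι.app j ≫ m' = _ ≫ t.ι.app j ≫ m W
    rw [← reassoc_of% hp i, hm', hm, hd]

/-- Every coproduct `∐ X` in `D` is the filtered colimit, over the stages, of the objects
`y.obj (∐ c_i)` attached to the families `y.obj c_i ⟶ X i`. -/
lemma exists_stage_presentation {X : I → D}
    [∀ j : Stage y κ X, HasCoproduct fun i => (j.obj i).left]
    {p : Cofan X} (hp : IsColimit p) :
    ∃ s : stageCoproduct y κ X ⋙ y ⟶ (Functor.const _).obj p.pt,
      Nonempty (IsColimit (Cocone.mk p.pt s)) ∧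
      ∀ j i, (j.obj i).hom ≫ p.inj i = y.map (stageι j i) ≫ s.app j := by
  obtain ⟨t, q, ⟨ht⟩, ⟨hq⟩, h⟩ := exists_stage_cofan y κ X
  let e : t.pt ≅ p.pt := hq.coconePointUniqueUpToIso hp
  have he (i : I) : q i ≫ e.hom = p.inj i := hq.comp_coconePointUniqueUpToIso_hom hp ⟨i⟩
  refine ⟨t.ι ≫ (Functor.const _).map e.hom,
    ⟨ht.ofIsoColimit (Cocone.ext e fun j => rfl)⟩, fun j i => ?_⟩
  rw [← he, reassoc_of% h j i]
  simp

end StageColimit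

/-! ### Coproducts are locally disjoint unions -/

section Ascent

variable {C : Type w} [Category.{w} C] {D : Type u} [Category.{w} D] (y : C ⥤ D)
  (κ : Cardinal.{w}) {I : Type w} {X : I → D}

variable [Fact κ.IsRegular] [∀ j : Stage y κ X, HasCoproduct fun i => (j.obj i).left]

variable {y κ} in
/-- Any `κ`-small set of indices is contained in a `κ`-small set whose summands determine the
coproduct attached to a given stage. -/
lemma exists_isColimit_restrict_stageι (j : Stage y κ X) (S₀ : Set I) (hS₀ : HasCardinalLT S₀ κ) :
    ∃ S : Set I, HasCardinalLT S κ ∧ S₀ ⊆ S ∧ Nonempty (IsColimit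
      (Cofan.mk (f := fun s : S => (j.obj s).left) ((stageCoproduct y κ X).obj j)
        fun s => stageι j s)) := by
  obtain ⟨S, hS, h⟩ := j.property
  exact ⟨S₀ ∪ S, hasCardinalLT_union (Cardinal.IsRegular.aleph0_le Fact.out) hS₀ hS,
    Set.subset_union_left, (nonempty_isColimit_cofan_iff_restrict _
      (fun i hi => h i fun h' => hi (Or.inr h')) _).1 ⟨isColimitStageι j⟩⟩

section

variable [HasInitial C] (hC : ∀ S : Type w, HasCardinalLT S κ → CoproductSquaresArePullbacks C S)

include hC

variable {y κ} in
lemma mono_stageι (j : Stage y κ X) (i : I) : Mono (stageι j i) := by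
  obtain ⟨S, hS, hi, ⟨h⟩⟩ := exists_isColimit_restrict_stageι j {i}
    (hasCardinalLT_of_finite _ _ (Cardinal.IsRegular.aleph0_le Fact.out))
  exact (hC S hS).mono_inj h ⟨i, hi rfl⟩

variable {y κ} in
lemma isInitial_of_comp_stageι_eq (j : Stage y κ X) {i i' : I} (hi : i ≠ i') {c : C}
    (x : c ⟶ (j.obj i).left) (x' : c ⟶ (j.obj i').left)
    (hx : x ≫ stageι j i = x' ≫ stageι j i') : Nonempty (IsInitial c) := by
  obtain ⟨S, hS, hi, ⟨h⟩⟩ := exists_isColimit_restrict_stageι j {i, i'}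
    (hasCardinalLT_of_finite _ _ (Cardinal.IsRegular.aleph0_le Fact.out))
  exact (hC S hS).isInitial_of_comp_inj_eq h (i := ⟨i, hi (by simp)⟩) (j := ⟨i', hi (by simp)⟩)
    (by simpa using ‹i ≠ i'›) x x' hx

end

/-- A cofan in `D` which, on morphisms from objects of `C`, looks like a disjoint union for the
topology of `κ`-small coproduct decompositions: the injections are injective with disjoint images,
and every morphism to the apex locally factors through one of them. -/
structure IsLocalDisjointUnion (p : Cofan X) : Prop where
  eq_of_comp_inj_eq {i : I} {c : C} (x x' : y.obj c ⟶ X i)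
    (h : x ≫ p.inj i = x' ≫ p.inj i) : x = x'
  isInitial_of_comp_inj_eq {i i' : I} (hi : i ≠ i') {c : C} (x : y.obj c ⟶ X i)
    (x' : y.obj c ⟶ X i') (h : x ≫ p.inj i = x' ≫ p.inj i') : Nonempty (IsInitial c)
  exists_cover {c : C} (t : y.obj c ⟶ p.pt) :
    ∃ (S : Type w) (_ : HasCardinalLT S κ) (b : S → C) (a : ∀ s, b s ⟶ c),
      Nonempty (IsColimit (Cofan.mk c a)) ∧
      ∀ s, ∃ (i : I) (x : y.obj (b s) ⟶ X i), y.map (a s) ≫ t = x ≫ p.inj i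

variable [∀ X, IsCardinalFiltered (CostructuredArrow y X) κ]
  [HasInitial C] [y.IsDense] [y.Faithful] [HasCardinalFilteredColimits D κ]
  [∀ c, IsCardinalPresentable (y.obj c) κ]

/-- If morphisms `y.obj c ⟶ X i` and `y.obj c ⟶ X i'` agree in `∐ X`, they already agree at some
stage. -/
lemma exists_stage_of_comp_inj_eq {p : Cofan X} (hp : IsColimit p) {i i' : I} {c : C}
    (x : y.obj c ⟶ X i) (x' : y.obj c ⟶ X i') (h : x ≫ p.inj i = x' ≫ p.inj i') :
    ∃ (k : Stage y κ X) (v : c ⟶ (k.obj i).left) (v' : c ⟶ (k.obj i').left),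
      y.map v ≫ (k.obj i).hom = x ∧ y.map v' ≫ (k.obj i').hom = x' ∧
      v ≫ stageι k i = v' ≫ stageι k i' := by
  have := isFiltered_of_isCardinalFiltered (Stage y κ X) κ
  have hfac {i : I} (x : y.obj c ⟶ X i) :
      ∃ (j : Stage y κ X) (v : c ⟶ (j.obj i).left), y.map v ≫ (j.obj i).hom = x := by
    obtain ⟨j, ⟨v⟩⟩ := ((Functor.final_iff_of_isFiltered (stageEval y κ X i)).1 inferInstance).1
      (CostructuredArrow.mk x)
    exact ⟨j, v.left, CostructuredArrow.w v⟩
  obtain ⟨s, ⟨hs⟩, hsp⟩ := exists_stage_presentation y κ hp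
  obtain ⟨j, v, rfl⟩ := hfac x
  obtain ⟨j', v', rfl⟩ := hfac x'
  obtain ⟨k, f, f', hk⟩ := IsCardinalPresentable.exists_eq_of_isColimit κ hs
    (y.map (v ≫ stageι j i)) (y.map (v' ≫ stageι j' i')) (by simpa [hsp] using h)
  refine ⟨k, v ≫ (f.hom i).left, v' ≫ (f'.hom i').left, ?_, ?_, ?_⟩
  · rw [y.map_comp, Category.assoc, CostructuredArrow.w]
  · rw [y.map_comp, Category.assoc, CostructuredArrow.w]
  · rw [Category.assoc, Category.assoc, ← stageι_map, ← stageι_map]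
    exact y.map_injective (by simpa using hk)

variable [y.Full] in
/-- If `C` is `κ`-extensive, coproducts in `D` are local disjoint unions: the three properties hold
at each stage, by extensivity of `C`. -/
lemma isLocalDisjointUnion_of_isColimit
    (h₁ : ∀ S : Type w, HasCardinalLT S κ → CoproductSquaresArePullbacks C S)
    (h₂ : ∀ S : Type w, HasCardinalLT S κ → MorphismsToCoproductsDecompose C S)
    {p : Cofan X} (hp : IsColimit p) : IsLocalDisjointUnion y κ p where
  eq_of_comp_inj_eq {i c} x x' h := by
    obtain ⟨k, v, v', rfl, rfl, hv⟩ := exists_stage_of_comp_inj_eq y κ hp x x' h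
    have := mono_stageι h₁ k i
    rw [(cancel_mono _).1 hv]
  isInitial_of_comp_inj_eq {i i'} hi c x x' h := by
    obtain ⟨k, v, v', rfl, rfl, hv⟩ := exists_stage_of_comp_inj_eq y κ hp x x' h
    exact isInitial_of_comp_stageι_eq h₁ k hi v v' hv
  exists_cover {c} t := by
    obtain ⟨s, ⟨hs⟩, hsp⟩ := exists_stage_presentation y κ hp
    obtain ⟨j, t, rfl⟩ := IsCardinalPresentable.exists_hom_of_isColimit κ hs t
    obtain ⟨t, rfl⟩ := y.map_surjective t
    obtain ⟨S, hS, -, ⟨h⟩⟩ := exists_isColimit_restrict_stageι j ∅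
      (hasCardinalLT_of_finite _ _ (Cardinal.IsRegular.aleph0_le Fact.out))
    obtain ⟨b, f, a, ha, hf⟩ := h₂ S hS _ h t
    refine ⟨S, hS, b, a, ha, fun s => ⟨s, y.map (f s) ≫ (j.obj s).hom, ?_⟩⟩
    have := y.congr_map (hf s)
    rw [Category.assoc, hsp, ← y.map_comp_assoc]
    dsimp at this ⊢
    rw [this, y.map_comp, Category.assoc]

end Ascent

/-! ### From the subcategory to its free completion -/

section Glue

variable {C : Type w} [Category.{w} C] {D : Type u} [Category.{w} D] {y : C ⥤ D}
  {κ : Cardinal.{w}} [Fact κ.IsRegular] [∀ X, IsCardinalFiltered (CostructuredArrow y X) κ]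
  {S : Type w} {b : S → C} {c : C} {a : ∀ s, b s ⟶ c}

lemma exists_hom_of_isColimit_cofan (hS : HasCardinalLT S κ) (ha : IsColimit (Cofan.mk c a))
    {W : D} (m : ∀ s, y.obj (b s) ⟶ W) : ∃ l : y.obj c ⟶ W, ∀ s, y.map (a s) ≫ l = m s := by
  obtain ⟨h⟩ := nonempty_isColimit_map_cofan y κ hS ha
  exact ⟨Cofan.IsColimit.desc h m, Cofan.IsColimit.fac h m⟩

lemma hom_ext_of_isColimit_cofan (hS : HasCardinalLT S κ) (ha : IsColimit (Cofan.mk c a))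
    {W : D} {l l' : y.obj c ⟶ W} (h : ∀ s, y.map (a s) ≫ l = y.map (a s) ≫ l') : l = l' := by
  obtain ⟨ha⟩ := nonempty_isColimit_map_cofan y κ hS ha
  exact Cofan.IsColimit.hom_ext ha _ _ h

namespace IsLocalDisjointUnion

variable {I : Type w} {X : I → D} {p : Cofan X}

/-- Morphisms between local disjoint unions yield pullback squares: a morphism `y.obj c ⟶ ∐ A` whose
image lies in `X i` factors locally, hence globally, through `A i`, since the pieces of `c` landing in
the other summands are initial. -/
lemma isPullback [y.IsDense] (hp : IsLocalDisjointUnion y κ p) {A : I → D} {a : Cofan A}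
    (ha : IsLocalDisjointUnion y κ a) (f : ∀ i, A i ⟶ X i) (g : a.pt ⟶ p.pt)
    (hg : ∀ i, a.inj i ≫ g = f i ≫ p.inj i) (i : I) :
    IsPullback (a.inj i) (f i) g (p.inj i) := by
  refine isPullback_of_isDense (y := y) (hg i) (fun c u v huv => ?_)
    fun c l l' h _ => ha.eq_of_comp_inj_eq l l' h
  obtain ⟨S, hS, b, q, ⟨hq⟩, h⟩ := ha.exists_cover u
  have key (s : S) : ∃ l : y.obj (b s) ⟶ A i, l ≫ a.inj i = y.map (q s) ≫ u := by
    obtain ⟨i', x, hx⟩ := h s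
    by_cases hi : i' = i
    · subst hi
      exact ⟨x, hx.symm⟩
    · obtain ⟨hb⟩ := hp.isInitial_of_comp_inj_eq hi (x ≫ f i') (y.map (q s) ≫ v) (by
        rw [Category.assoc, ← hg, ← reassoc_of% hx, huv, Category.assoc])
      obtain ⟨hb⟩ := nonempty_isInitial_map y κ hb
      exact ⟨hb.to _, hb.hom_ext _ _⟩
  choose l hl using key
  obtain ⟨m, hm⟩ := exists_hom_of_isColimit_cofan hS hq l
  refine ⟨m, hom_ext_of_isColimit_cofan hS hq fun s => ?_,
    hom_ext_of_isColimit_cofan hS hq fun s => hp.eq_of_comp_inj_eq _ _ ?_⟩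
  · rw [reassoc_of% hm, hl]
  · rw [reassoc_of% hm, Category.assoc, ← hg, reassoc_of% hl, huv, Category.assoc]

/-- If `A i` is the pullback of `X i ⟶ p.pt` along `g : Z ⟶ p.pt`, then `∐ A ⟶ Z` is an
isomorphism. -/
lemma isIso [y.IsDense] (hp : IsLocalDisjointUnion y κ p) {A : I → D} {a : Cofan A}
    (ha : IsLocalDisjointUnion y κ a) {f : ∀ i, A i ⟶ X i} {Z : D} {g : Z ⟶ p.pt}
    {a' : ∀ i, A i ⟶ Z} (sq : ∀ i, IsPullback (a' i) (f i) g (p.inj i)) (φ : a.pt ⟶ Z)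
    (hφ : ∀ i, a.inj i ≫ φ = a' i) : IsIso φ := by
  refine isIso_of_isDense (y := y) φ fun c => ⟨fun u u' huu' => ?_, fun z => ?_⟩
  · -- It suffices to treat the case where `u` factors through a summand `A i`.
    have hone {c : C} (i : I) (x : y.obj c ⟶ A i) (u' : y.obj c ⟶ a.pt)
        (h : x ≫ a' i = u' ≫ φ) : x ≫ a.inj i = u' := by
      obtain ⟨S, hS, b, q, ⟨hq⟩, hc⟩ := ha.exists_cover u'
      refine hom_ext_of_isColimit_cofan hS hq fun s => ?_
      obtain ⟨i', x', hx'⟩ := hc s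
      have hxx : y.map (q s) ≫ x ≫ a' i = x' ≫ a' i' := by
        rw [h, reassoc_of% hx', hφ]
      have hXX : (y.map (q s) ≫ x ≫ f i) ≫ p.inj i = (x' ≫ f i') ≫ p.inj i' := by
        simp only [Category.assoc, ← (sq _).w, reassoc_of% hxx]
      by_cases hi : i = i'
      · subst hi
        have : y.map (q s) ≫ x = x' := (sq i).hom_ext (by simpa using hxx)
          (by simpa using hp.eq_of_comp_inj_eq _ _ hXX)
        rw [hx', reassoc_of% this]
      · obtain ⟨hb⟩ := hp.isInitial_of_comp_inj_eq hi _ _ hXX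
        obtain ⟨hb⟩ := nonempty_isInitial_map y κ hb
        exact hb.hom_ext _ _
    obtain ⟨S, hS, b, q, ⟨hq⟩, hc⟩ := ha.exists_cover u
    refine hom_ext_of_isColimit_cofan hS hq fun s => ?_
    obtain ⟨i, x, hx⟩ := hc s
    rw [hx]
    refine hone i x _ ?_
    rw [← hφ, ← reassoc_of% hx, Category.assoc]
    exact congr_arg _ huu'
  · obtain ⟨S, hS, b, q, ⟨hq⟩, hc⟩ := hp.exists_cover (z ≫ g)
    have key (s : S) : ∃ u : y.obj (b s) ⟶ a.pt, u ≫ φ = y.map (q s) ≫ z := by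
      obtain ⟨i, x, hx⟩ := hc s
      exact ⟨(sq i).lift (y.map (q s) ≫ z) x (by simpa using hx) ≫ a.inj i, by simp [hφ]⟩
    choose u hu using key
    obtain ⟨m, hm⟩ := exists_hom_of_isColimit_cofan hS hq u
    refine ⟨m, hom_ext_of_isColimit_cofan hS hq fun s => ?_⟩
    dsimp only
    rw [reassoc_of% hm, hu]

end IsLocalDisjointUnion

end Glue

section Ascent

variable {C : Type w} [Category.{w} C] {D : Type u} [Category.{w} D] (y : C ⥤ D)
  (κ : Cardinal.{w}) [Fact κ.IsRegular] [∀ X, IsCardinalFiltered (CostructuredArrow y X) κ]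
  [HasInitial C] [y.IsDense] [y.Full] [y.Faithful] [HasCardinalFilteredColimits D κ]
  [∀ c, IsCardinalPresentable (y.obj c) κ] [HasPullbacks D]

include y in
/-- If `C` is `κ`-extensive, then a category `D` generated by `C` under `κ`-filtered colimits, in
which the objects of `C` are `κ`-presentable, is infinitary extensive. -/
theorem isInfinitaryExtensive_of_isCardinalExtensive (h : IsCardinalExtensive C κ) :
    IsInfinitaryExtensive.{w} D := by
  intro I
  have hC (S : Type w) (hS : HasCardinalLT S κ) : HasCoproductsOfShape S C := (h S hS).1
  have (X : I → D) (j : Stage y κ X) : HasCoproduct fun i => (j.obj i).left :=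
    hasCoproduct_stage y hC j
  have hD {X : I → D} {p : Cofan X} (hp : IsColimit p) : IsLocalDisjointUnion y κ p :=
    isLocalDisjointUnion_of_isColimit y κ (fun S hS => (h S hS).pullbacks)
      (fun S hS => (h S hS).decompose) hp
  have hcop (X : I → D) : ∃ p : Cofan X, Nonempty (IsColimit p) := by
    obtain ⟨t, p, -, hp, -⟩ := exists_stage_cofan y κ X
    exact ⟨_, hp⟩
  have : HasCoproductsOfShape I D := by
    have (X : I → D) : HasCoproduct X := by
      obtain ⟨p, ⟨hp⟩⟩ := hcop X
      exact ⟨⟨_, hp⟩⟩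
    exact ⟨fun F => hasColimit_of_iso Discrete.natIsoFunctor⟩
  refine extensiveOfShape_of_pullbacks_of_decompose
    (fun X A a p ha hp f g hg i => (hD hp).isPullback (hD ha) f g hg i) fun X p hp Z g => ?_
  obtain ⟨a, ⟨ha⟩⟩ := hcop fun i => pullback g (p.inj i)
  let φ : a.pt ⟶ Z := Cofan.IsColimit.desc ha fun i => pullback.fst _ _
  have hφ (i : I) : a.inj i ≫ φ = pullback.fst _ _ := Cofan.IsColimit.fac ha _ i
  have := (hD hp).isIso (hD ha) (fun i => IsPullback.of_hasPullback g (p.inj i)) φ hφ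
  exact ⟨_, fun i => pullback.snd _ _, fun i => pullback.fst _ _,
    ⟨ha.ofIsoColimit (Cofan.ext (asIso φ) hφ)⟩, fun i => pullback.condition⟩

end Ascent

/-! ### From the free completion to the subcategory -/

section Descent

variable {C : Type w} [Category.{w} C] {D : Type u} [Category.{w} D] (y : C ⥤ D)

/-- If `C` is idempotent complete, every retract in `D` of an object of `C` comes from `C`. -/
lemma exists_iso_of_retract [y.Full] [y.Faithful] [IsIdempotentComplete C] {A : D} {c : C}
    (i : A ⟶ y.obj c) (r : y.obj c ⟶ A) (h : i ≫ r = 𝟙 A) : ∃ z : C, Nonempty (A ≅ y.obj z) := by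
  obtain ⟨e, he⟩ := y.map_surjective (r ≫ i)
  obtain ⟨z, i', r', h₁, h₂⟩ := IsIdempotentComplete.idempotents_split c e
    (y.map_injective (by simp [he, reassoc_of% h]))
  have h₁' : y.map i' ≫ y.map r' = 𝟙 _ := by rw [← y.map_comp, h₁, y.map_id]
  have h₂' : y.map r' ≫ y.map i' = r ≫ i := by rw [← y.map_comp, h₂, he]
  refine ⟨z, ⟨⟨i ≫ y.map r', y.map i' ≫ r, ?_, ?_⟩⟩⟩
  · rw [Category.assoc, reassoc_of% h₂', h, Category.comp_id, h]
  · rw [Category.assoc, ← reassoc_of% h₂', h₁', Category.comp_id, h₁']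

variable {y} in
lemma nonempty_isColimit_of_map [y.Full] [y.Faithful] {S : Type w} {x : S → C} {p : Cofan x}
    (hp : IsColimit (Cofan.mk (f := fun s => y.obj (x s)) (y.obj p.pt) fun s => y.map (p.inj s))) :
    Nonempty (IsColimit p) :=
  ⟨isColimitOfReflects y ((Cofan.isColimitMapCoconeEquiv y x p).symm hp)⟩

variable (κ : Cardinal.{w}) [Fact κ.IsRegular] [∀ X, IsCardinalFiltered (CostructuredArrow y X) κ]
  [y.Full] [y.Faithful]

include y in
lemma coproductSquaresArePullbacks_of_map {S : Type w} (hS : HasCardinalLT S κ)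
    (h : CoproductSquaresArePullbacks D S) : CoproductSquaresArePullbacks C S := by
  intro X A a p ha hp f g hg i
  obtain ⟨ha'⟩ := nonempty_isColimit_map_cofan y κ hS ha
  obtain ⟨hp'⟩ := nonempty_isColimit_map_cofan y κ hS hp
  exact IsPullback.of_map y (hg i) (h _ _ ha' hp' (fun i => y.map (f i)) (y.map g)
    (fun i => by simpa using y.congr_map (hg i)) i)

variable [HasInitial C] [y.IsDense] [HasCardinalFilteredColimits D κ]
  [∀ c, IsCardinalPresentable (y.obj c) κ] [IsIdempotentComplete C]

/-- If the object `y.obj Z` is a `κ`-small coproduct in `D`, then the summands come from `C`.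
Indeed `y.obj Z` is a filtered colimit of coproducts attached to stages; as it is `κ`-presentable,
it is a retract of one of them, and this retraction restricts to each summand because coproduct
squares are pullbacks. -/
lemma exists_iso_of_isColimit_cofan {S : Type w} (h : CoproductSquaresArePullbacks D S) {A : S → D}
    {Z : C} {a : ∀ s, A s ⟶ y.obj Z} (ha : IsColimit (Cofan.mk (y.obj Z) a))
    [∀ j : Stage y κ A, HasCoproduct fun i => (j.obj i).left] (i : S) :
    ∃ z : C, Nonempty (A i ≅ y.obj z) := by
  obtain ⟨s, ⟨hs⟩, hsa⟩ := exists_stage_presentation y κ ha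
  -- `t` is a section of the morphism `s.app j` from the `j`-th stage.
  obtain ⟨j, t, ht⟩ := IsCardinalPresentable.exists_hom_of_isColimit κ hs (𝟙 (y.obj Z))
  obtain ⟨hL⟩ := nonempty_isColimit_map_stageCoproduct y κ j
  have sq := h _ _ hL ha (fun i => (j.obj i).hom) (s.app j) (fun i => (hsa j i).symm) i
  have w : (a i ≫ t) ≫ s.app j = 𝟙 (A i) ≫ a i := by
    rw [Category.assoc, Category.id_comp]
    exact (congr_arg _ ht).trans (Category.comp_id _)
  exact exists_iso_of_retract y (sq.lift (a i ≫ t) (𝟙 (A i)) w) _ (sq.lift_snd _ _ w)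

include y in
lemma morphismsToCoproductsDecompose_of_map
    (hC : ∀ S : Type w, HasCardinalLT S κ → HasCoproductsOfShape S C)
    {S : Type w} (hS : HasCardinalLT S κ) (h₁ : CoproductSquaresArePullbacks D S)
    (h₂ : MorphismsToCoproductsDecompose D S) : MorphismsToCoproductsDecompose C S := by
  intro X p hp Z g
  obtain ⟨hp'⟩ := nonempty_isColimit_map_cofan y κ hS hp
  obtain ⟨A, f, a, ⟨ha⟩, hf⟩ := h₂ _ hp' (y.map g)
  have (j : Stage y κ A) : HasCoproduct fun i => (j.obj i).left := hasCoproduct_stage y hC j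
  choose z e using fun i => exists_iso_of_isColimit_cofan y κ h₁ ha i
  replace e (i : S) := (e i).some
  choose a' ha' using fun i => y.map_surjective ((e i).inv ≫ a i)
  choose f' hf' using fun i => y.map_surjective ((e i).inv ≫ f i)
  refine ⟨z, f', a', nonempty_isColimit_of_map (y := y) ?_, fun i => y.map_injective ?_⟩
  · refine Cofan.IsColimit.mk _ (fun t => Cofan.IsColimit.desc ha fun i => (e i).hom ≫ t.inj i)
      (fun t i => ?_) fun t m hm => Cofan.IsColimit.hom_ext ha _ _ fun i => ?_
    · have := Cofan.IsColimit.fac ha (fun i => (e i).hom ≫ t.inj i) i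
      change y.map (a' i) ≫ _ = _
      rw [ha', Category.assoc, Iso.inv_comp_eq]
      exact this
    · have := Cofan.IsColimit.fac ha (fun i => (e i).hom ≫ t.inj i) i
      refine Eq.trans ?_ this.symm
      change a i ≫ m = _
      rw [← hm i]
      change _ = _ ≫ y.map (a' i) ≫ m
      rw [ha', Category.assoc, Iso.hom_inv_id_assoc]
  · rw [y.map_comp, y.map_comp, ha', hf', Category.assoc, Category.assoc]
    exact congr_arg _ (hf i)

include y in
/-- If `C` has `κ`-small coproducts and is idempotent complete, and is a dense subcategory of
`κ`-presentable objects of a `κ`-extensive category `D`, then `C` is `κ`-extensive. -/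
theorem isCardinalExtensive_of_isCardinalExtensive
    (hC : ∀ S : Type w, HasCardinalLT S κ → HasCoproductsOfShape S C)
    (h : IsCardinalExtensive D κ) : IsCardinalExtensive C κ := fun S hS => by
  obtain ⟨h₀⟩ := nonempty_isInitial_map y κ (initialIsInitial (C := C))
  have := h₀.hasInitial
  have := hC S hS
  have h₁ := (h S hS).pullbacks
  exact extensiveOfShape_of_pullbacks_of_decompose (coproductSquaresArePullbacks_of_map y κ hS h₁)
    (morphismsToCoproductsDecompose_of_map y κ hC hS h₁ (h S hS).decompose)

end Descent

/-! ### Ind-objects and the category they form -/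

section CoproductsInC

variable {C : Type u} [Category.{v} C] {κ : Cardinal.{w}}

lemma IsCardinalCocomplete.hasCoproductsOfShape (hC : IsCardinalCocomplete C κ) (S : Type w)
    (hS : HasCardinalLT S κ) : HasCoproductsOfShape S C :=
  hC (Discrete S) ((hasCardinalLT_arrow_discrete_iff κ).2 hS)

variable [Fact κ.IsRegular]

lemma IsCardinalCocomplete.hasColimitsOfShape_of_finCategory (hC : IsCardinalCocomplete C κ)
    (J : Type) [SmallCategory J] [FinCategory J] : HasColimitsOfShape J C := by
  have : Finite (AsSmall.{w} J) := inferInstanceAs (Finite (ULift J))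
  have (X Y : AsSmall.{w} J) : Finite (X ⟶ Y) :=
    inferInstanceAs (Finite (ULift (AsSmall.down.obj X ⟶ AsSmall.down.obj Y)))
  have : Finite (Arrow (AsSmall.{w} J)) := Finite.of_equiv _ (Arrow.equivSigma _).symm
  have := hC (AsSmall.{w} J) (hasCardinalLT_of_finite _ _ (Cardinal.IsRegular.aleph0_le Fact.out))
  exact hasColimitsOfShape_of_equivalence (AsSmall.equiv (C := J)).symm

lemma IsCardinalCocomplete.hasInitial (hC : IsCardinalCocomplete C κ) : HasInitial C :=
  hC.hasColimitsOfShape_of_finCategory (Discrete PEmpty)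

/-- An idempotent `p` is split by the coequalizer of `p` and the identity. -/
lemma IsCardinalCocomplete.isIdempotentComplete (hC : IsCardinalCocomplete C κ) :
    IsIdempotentComplete C := by
  have := hC.hasColimitsOfShape_of_finCategory WalkingParallelPair
  refine ⟨fun X p hp => ⟨coequalizer (𝟙 X) p, coequalizer.desc p (by simp [hp]),
    coequalizer.π _ _, ?_, by simp⟩⟩
  ext
  simpa using (coequalizer.condition (𝟙 X) p).symm

end CoproductsInC

section IndObjects

variable {C : Type w} [SmallCategory C] (κ : Cardinal.{w}) [Fact κ.IsRegular]

instance isCardinalPresentable_yoneda_obj (c : C) : IsCardinalPresentable (yoneda.obj c) κ where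
  preservesColimitOfShape J _ _ := by
    let e : coyoneda.obj (Opposite.op (yoneda.obj c)) ≅ (evaluation Cᵒᵖ (Type w)).obj _ :=
      NatIso.ofComponents fun P => yonedaEquiv.toIso
    exact preservesColimitsOfShape_of_natIso e.symm

variable {κ}

/-- The presheaves preserving limits of a `κ`-small shape are stable under `κ`-filtered colimits:
they are the local objects for a family of morphisms between `κ`-presentable presheaves. -/
lemma isClosedUnderColimitsOfShape_preservesLimitsOfShape {A : Type w} [SmallCategory A]
    (hA : HasCardinalLT (Arrow A) κ) (J : Type w) [SmallCategory J] [IsCardinalFiltered J κ] :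
    (ObjectProperty.preservesLimitsOfShape Aᵒᵖ :
      ObjectProperty (Cᵒᵖ ⥤ Type w)).IsClosedUnderColimitsOfShape J := by
  have hy (c : C) : IsCardinalPresentable (shrinkYoneda.{w}.obj c) κ :=
    isCardinalPresentable_of_iso (shrinkYonedaIsoYoneda.app c).symm κ
  rw [Presheaf.preservesLimitsOfShape_eq_isLocal.{w}]
  refine MorphismProperty.isClosedUnderColimitsOfShape_isLocal _ J κ fun X Y f hf => ?_
  simp only [MorphismProperty.iSup_iff] at hf
  obtain ⟨F, ⟨h⟩⟩ := hf
  have (k : Aᵒᵖᵒᵖ) : IsCardinalPresentable ((F.leftOp ⋙ shrinkYoneda.{w}).obj k) κ := hy _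
  exact ⟨isCardinalPresentable_of_isColimit _ (colimit.isColimit (F.leftOp ⋙ shrinkYoneda.{w})) κ
    (by simpa using hA), hy _⟩

/-- For a `κ`-filtered colimit `P` of representable presheaves, the functor from the indexing
category to the category of representable presheaves over `P` is final. -/
lemma IsCardinalIndObject.isCardinalFiltered {P : Cᵒᵖ ⥤ Type w} (hP : IsCardinalIndObject κ P) :
    IsCardinalFiltered (CostructuredArrow yoneda P) κ := by
  obtain ⟨J, _, _, F, ι, ⟨h⟩⟩ := hP
  have := Presheaf.final_toCostructuredArrow_comp_pre F h
  exact IsCardinalFiltered.of_final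
    ((Cocone.mk P ι).toCostructuredArrow ⋙ CostructuredArrow.pre F yoneda P) κ

lemma isCardinalIndObject_of_isCardinalFiltered (P : Cᵒᵖ ⥤ Type w)
    [IsCardinalFiltered (CostructuredArrow yoneda P) κ] : IsCardinalIndObject κ P :=
  ⟨CostructuredArrow yoneda P, _, inferInstance, CostructuredArrow.proj _ _,
    (Presheaf.tautologicalCocone P).ι, ⟨Presheaf.isColimitTautologicalCocone P⟩⟩

/-- If `C` has `κ`-small colimits, the `κ`-ind-objects are the presheaves sending `κ`-small colimits
to limits. -/
lemma isCardinalIndObject_iff (hC : IsCardinalCocomplete C κ) (P : Cᵒᵖ ⥤ Type w) :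
    IsCardinalIndObject κ P ↔ ∀ (A : Type w) [SmallCategory A], HasCardinalLT (Arrow A) κ →
      PreservesLimitsOfShape Aᵒᵖ P := by
  constructor
  · rintro ⟨J, _, _, F, ι, ⟨h⟩⟩ A _ hA
    have := isClosedUnderColimitsOfShape_preservesLimitsOfShape (C := C) hA J
    exact ObjectProperty.prop_of_isColimit (ObjectProperty.preservesLimitsOfShape Aᵒᵖ) h
      fun j => inferInstanceAs (PreservesLimitsOfShape Aᵒᵖ (yoneda.obj (F.obj j)))
  · intro hP
    -- The category of elements inherits `κ`-small limits from `Cᵒᵖ`, as `P` preserves them.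
    have : IsCardinalFiltered P.Elementsᵒᵖ κ := ⟨fun {A} _ F hA => by
      have := hP A hA
      have := hC A hA
      have := hasColimitsOfShape_of_equivalence (C := C) (opOpEquivalence A).symm
      have : HasLimitsOfShape Aᵒᵖ Cᵒᵖ := hasLimitsOfShape_op_of_hasColimitsOfShape
      exact ⟨coconeOfConeLeftOp (limit.cone F.leftOp)⟩⟩
    have := IsCardinalFiltered.of_equivalence κ
      (CategoryOfElements.costructuredArrowYonedaEquivalence P)
    exact isCardinalIndObject_of_isCardinalFiltered P

lemma isClosedUnderColimitsOfShape_isCardinalIndObject (hC : IsCardinalCocomplete C κ)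
    (J : Type w) [SmallCategory J] [IsCardinalFiltered J κ] :
    (IsCardinalIndObject (C := C) κ).IsClosedUnderColimitsOfShape J where
  colimitsOfShape_le P := fun ⟨h⟩ => (isCardinalIndObject_iff hC P).2 fun A _ hA =>
    have := isClosedUnderColimitsOfShape_preservesLimitsOfShape (C := C) hA J
    ObjectProperty.prop_of_isColimit (ObjectProperty.preservesLimitsOfShape Aᵒᵖ) h.isColimit
      fun j => (isCardinalIndObject_iff hC _).1 (h.prop_diag_obj j) A hA

lemma isClosedUnderLimitsOfShape_isCardinalIndObject (hC : IsCardinalCocomplete C κ)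
    (J : Type u) [Category.{v} J] :
    (IsCardinalIndObject (C := C) κ).IsClosedUnderLimitsOfShape J where
  limitsOfShape_le P := fun ⟨h⟩ => (isCardinalIndObject_iff hC P).2 fun A _ hA => by
    have : (ObjectProperty.preservesLimitsOfShape Aᵒᵖ :
        ObjectProperty (Cᵒᵖ ⥤ Type w)).IsClosedUnderLimitsOfShape J := by
      rw [Presheaf.preservesLimitsOfShape_eq_isLocal.{w}]
      infer_instance
    exact ObjectProperty.prop_of_isLimit (ObjectProperty.preservesLimitsOfShape Aᵒᵖ) h.isLimit
      fun j => (isCardinalIndObject_iff hC _).1 (h.prop_diag_obj j) A hA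

end IndObjects

section IndCategory

variable (C : Type w) [SmallCategory C] (κ : Cardinal.{w}) [Fact κ.IsRegular]

lemma isCardinalIndObject_yoneda_obj (c : C) : IsCardinalIndObject κ (yoneda.obj c) :=
  -- The identity of `yoneda.obj c` is a terminal object.
  have : IsCardinalFiltered (CostructuredArrow yoneda (yoneda.obj c)) κ :=
    ⟨fun F _ => ⟨⟨_, { app a := CostructuredArrow.mkIdTerminal.from (F.obj a)
                       naturality _ _ _ := CostructuredArrow.mkIdTerminal.hom_ext _ _ }⟩⟩⟩
  isCardinalIndObject_of_isCardinalFiltered _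

/-- The Yoneda embedding of `C` into its free completion under `κ`-filtered colimits. -/
def cardinalIndYoneda : C ⥤ CardinalInd C κ :=
  (IsCardinalIndObject κ).lift yoneda (isCardinalIndObject_yoneda_obj C κ)

instance : (cardinalIndYoneda C κ).Full := inferInstanceAs (ObjectProperty.lift _ _ _).Full
instance : (cardinalIndYoneda C κ).Faithful := inferInstanceAs (ObjectProperty.lift _ _ _).Faithful

instance (X : CardinalInd C κ) :
    IsCardinalFiltered (CostructuredArrow (cardinalIndYoneda C κ) X) κ :=
  have : IsCardinalFiltered (CostructuredArrow
      (cardinalIndYoneda C κ ⋙ (IsCardinalIndObject κ).ι) ((IsCardinalIndObject κ).ι.obj X)) κ :=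
    X.property.isCardinalFiltered
  IsCardinalFiltered.of_equivalence κ (CostructuredArrow.post (cardinalIndYoneda C κ)
    (IsCardinalIndObject κ).ι X).asEquivalence.symm

/-- Density is inherited from the Yoneda embedding, as the inclusion in the category of presheaves
reflects colimits. -/
instance : (cardinalIndYoneda C κ).IsDense where
  isDenseAt X := ⟨isColimitOfReflects (IsCardinalIndObject κ).ι <|
    (((yoneda (C := C)).denseAt X.obj).whiskerEquivalence
      (CostructuredArrow.post (cardinalIndYoneda C κ)
        (IsCardinalIndObject κ).ι X).asEquivalence).ofIsoColimit (Cocone.ext (Iso.refl _))⟩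

variable {C κ} (hC : IsCardinalCocomplete C κ)

include hC

lemma hasPullbacks_cardinalInd : HasPullbacks (CardinalInd C κ) :=
  have := isClosedUnderLimitsOfShape_isCardinalIndObject hC WalkingCospan
  inferInstance

lemma hasCardinalFilteredColimits_cardinalInd :
    HasCardinalFilteredColimits (CardinalInd C κ) κ where
  hasColimitsOfShape J _ _ :=
    have := isClosedUnderColimitsOfShape_isCardinalIndObject hC J
    inferInstance

lemma isCardinalPresentable_cardinalIndYoneda_obj (c : C) :
    IsCardinalPresentable ((cardinalIndYoneda C κ).obj c) κ where
  preservesColimitOfShape J _ _ := by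
    have := isClosedUnderColimitsOfShape_isCardinalIndObject hC J
    let e : coyoneda.obj (Opposite.op ((cardinalIndYoneda C κ).obj c)) ≅
        (IsCardinalIndObject κ).ι ⋙ coyoneda.obj (Opposite.op (yoneda.obj c)) :=
      NatIso.ofComponents fun P => (ObjectProperty.fullyFaithfulι _).homEquiv.toIso
    have := preservesColimitsOfShape_of_isCardinalPresentable (yoneda.obj c) κ J
    exact preservesColimitsOfShape_of_natIso e.symm

end IndCategory

end KappaInd

theorem mainTheorem6 (κ : Cardinal.{w}) [Fact κ.IsRegular] (C : Type w) [SmallCategory C]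
    (hC : KappaInd.IsCardinalCocomplete C κ) :
    List.TFAE
      [KappaInd.IsCardinalExtensive C κ,
       KappaInd.IsInfinitaryExtensive.{w} (KappaInd.CardinalInd C κ),
       KappaInd.IsCardinalExtensive (KappaInd.CardinalInd C κ) κ] := by
  have := hC.hasInitial
  have := hC.isIdempotentComplete
  have := KappaInd.hasPullbacks_cardinalInd hC
  have := KappaInd.hasCardinalFilteredColimits_cardinalInd hC
  have := KappaInd.isCardinalPresentable_cardinalIndYoneda_obj hC
  tfae_have 1 → 2 := KappaInd.isInfinitaryExtensive_of_isCardinalExtensive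
    (KappaInd.cardinalIndYoneda C κ) κ
  tfae_have 2 → 3 := fun h I _ => h I
  tfae_have 3 → 1 := KappaInd.isCardinalExtensive_of_isCardinalExtensive
    (KappaInd.cardinalIndYoneda C κ) κ hC.hasCoproductsOfShape
  tfae_finish
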